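/- Let $1\le j\le d$ be integers, let $D\subset\mathbb{R}^d$ be open, let $G:D\to\mathbb{R}^j$ be of class $C^1$ with Jacobian matrix $\nabla G(x)\in\mathbb{R}^{j\times d}$, and let $B\subset D$ be a Borel set. Put $J_G(x):=\det\big(\nabla G(x)\nabla G(x)^{T}\big)^{1/2}$, let $D^r_G:=\{x\in D:\ \operatorname{rank}\nabla G(x)=j\}$, and for $y\in\mathbb{R}^j$ let $$\mathcal{C}^{D^r}_{B,G}(y):=\{x\in B\cap D^r_G:\ G(x)=y\}.$$ Let $\sigma_{d-j}$ be the $(d-j)$-dimensional area measure in $\mathbb{R}^d$, that is, the $(d-j)$-dimensional Euclidean Hausdorff measure, normalized to agree with Lebesgue measure on $\mathbb{R}^{d-j}$ (the counting measure if $j=d$). Measurable means Borel measurable, and $0\cdot\infty=0$. (i) For every measurable $f:\mathbb{R}^j\to[0,\infty]$, the integrand on the right-hand side below is Lebesgue measurable and, with values in $[0,\infty]$, $$\int_B f(G(x))\,J_G(x)\,dx=\int_{\mathbb{R}^j} f(y)\,\sigma_{d-j}\big(\mathcal{C}^{D^r}_{B,G}(y)\big)\,dy.\qquad(1)$$ (ii)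 Let $f:\mathbb{R}^j\to\mathbb{R}$ be measurable, and suppose that at least one of the two integrals in (1) is finite when $f$ is replaced by $|f|$. Then $\sigma_{d-j}(\mathcal{C}^{D^r}_{B,G}(y))<\infty$ for almost every $y$ with $f(y)\ne0$, both integrals in (1) converge absolutely, and (1) holds. (iii) For every measurable $h:\mathbb{R}^d\times\mathbb{R}^j\to[0,\infty]$, the outer integrand on the right-hand side below is Lebesgue measurable and, with values in $[0,\infty]$, $$\int_B h(x,G(x))\,J_G(x)\,dx=\int_{\mathbb{R}^j}\Big[\int_{\mathcal{C}^{D^r}_{B,G}(y)}h(x,y)\,d\sigma_{d-j}(x)\Big]dy.\qquad(2)$$ (iv) Let $h:\mathbb{R}^d\times\mathbb{R}^j\to\mathbb{R}$ be measurable, and suppose that at least one of the two integrals in (2) is finite when $h$ is replaced by $|h|$. Then $x\mapsto h(x,G(x))J_G(x)$ is integrable on $B$, for almost every $y$ the function $x\mapsto h(x,y)$ is $\sigma_{d-j}$-integrable on $\mathcal{C}^{D^r}_{B,G}(y)$, the function of $y$ given by the inner integral is integrable on $\mathbb{R}^j$, and (2) holds. -/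

import Mathlib

open MeasureTheory

noncomputable section

/-- The Jacobian matrix `∇G(x)` of `G : ℝᵈ → ℝʲ` at `x`: the entry `(i, k)` is `∂Gᵢ/∂xₖ (x)`. -/
def jacobianMatrix {d j : ℕ} (G : EuclideanSpace ℝ (Fin d) → EuclideanSpace ℝ (Fin j))
    (x : EuclideanSpace ℝ (Fin d)) : Matrix (Fin j) (Fin d) ℝ :=
  Matrix.of fun i k => (fderiv ℝ G x (EuclideanSpace.single k 1)) i

/-- The coarea factor `det(∇G(x) ∇G(x)ᵀ)^{1/2}`. -/
def coareaFactor {d j : ℕ} (G : EuclideanSpace ℝ (Fin d) → EuclideanSpace ℝ (Fin j))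
    (x : EuclideanSpace ℝ (Fin d)) : ℝ :=
  Real.sqrt (jacobianMatrix G x * (jacobianMatrix G x).transpose).det

/-- The set `Dʳ_G` of the points of `D` at which `∇G` has maximal rank `j`. -/
def regularSet {d j : ℕ} (D : Set (EuclideanSpace ℝ (Fin d)))
    (G : EuclideanSpace ℝ (Fin d) → EuclideanSpace ℝ (Fin j)) :
    Set (EuclideanSpace ℝ (Fin d)) :=
  {x | x ∈ D ∧ (jacobianMatrix G x).rank = j}

/-- The level set `C_G(y) = {x ∈ D : G(x) = y}`. -/
def levelSet {d j : ℕ} (D : Set (EuclideanSpace ℝ (Fin d)))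
    (G : EuclideanSpace ℝ (Fin d) → EuclideanSpace ℝ (Fin j)) (y : EuclideanSpace ℝ (Fin j)) :
    Set (EuclideanSpace ℝ (Fin d)) :=
  {x | x ∈ D ∧ G x = y}

/-- The regular part `C^{Dʳ}_{B,G}(y) = C_G(y) ∩ B ∩ Dʳ_G` of the level set in `B`. -/
def regularLevelSet {d j : ℕ} (D : Set (EuclideanSpace ℝ (Fin d)))
    (G : EuclideanSpace ℝ (Fin d) → EuclideanSpace ℝ (Fin j))
    (B : Set (EuclideanSpace ℝ (Fin d))) (y : EuclideanSpace ℝ (Fin j)) :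
    Set (EuclideanSpace ℝ (Fin d)) :=
  levelSet D G y ∩ B ∩ regularSet D G

/-- The `k`-dimensional area measure `σₖ` on subsets of `ℝᵈ`: the `k`-dimensional Hausdorff measure
of the Euclidean metric, normalized so that it is Lebesgue measure on `ℝᵏ`
(and the counting measure for `k = 0`). -/
def areaMeasure (d k : ℕ) : Measure (EuclideanSpace ℝ (Fin d)) :=
  Measure.euclideanHausdorffMeasure k

end

/-! For a surjective linear map `L` the formula is Fubini plus a change of variables. The source
splits orthogonally as a copy of the target times `ker L`, fibres are translates of the kernel, and
`L` acts on the first factor by an automorphism `T` with `(det T)^2 = det (L L*)`.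

Near a regular point a map `F` with derivative the identity there turns `G` into its linearization
`A`, exactly: `A ∘ F = G`. So `F` carries fibres of `G` onto fibres of `A` and is bi-Lipschitz with
constants near `1`. The linear formula therefore transfers up to a factor `t > 1` as close to `1` as
desired (`exists_nhds_coarea_approx`). Countably many such neighbourhoods cover the regular set, the
two-sided estimates add over a disjoint partition, and `t → 1` yields both measurability and
equality (`coarea_measure`).

Read on all Borel sets, this says that mixing area measures on the regular level sets over `y` gives
the measure with density `J_G` on `B` (`bind_restrict_regularLevelSet`); critical points carry zero
density. On a fibre `h (x, y) = h (x, G x)`, so all four claims are integration against a mixture,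
with `h (x, y) = f y` for the first two. -/

open Module Set Filter Topology ContinuousLinearMap
open scoped ENNReal NNReal InnerProductSpace

/-! ### Surjective linear maps -/

section LinearCoarea

variable {E F : Type*} [NormedAddCommGroup E] [InnerProductSpace ℝ E] [FiniteDimensional ℝ E]
  [NormedAddCommGroup F] [InnerProductSpace ℝ F] [FiniteDimensional ℝ F]

theorem ContinuousLinearMap.det_comp_adjoint_self (T : F →L[ℝ] F) :
    LinearMap.det (T ∘L adjoint T : F →L[ℝ] F).toLinearMap = LinearMap.det T.toLinearMap ^ 2 := by
  have h : LinearMap.det (adjoint T).toLinearMap = LinearMap.det T.toLinearMap := by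
    let b := stdOrthonormalBasis ℝ F
    rw [← LinearMap.det_toMatrix b.toBasis, ← LinearMap.det_toMatrix b.toBasis T.toLinearMap]
    have := LinearMap.toMatrix_adjoint b b T.toLinearMap
    have h2 : (adjoint T).toLinearMap = LinearMap.adjoint T.toLinearMap := rfl
    rw [h2, this, Matrix.conjTranspose_eq_transpose_of_trivial, Matrix.det_transpose]
  rw [toLinearMap_comp, LinearMap.det_comp, h, sq]

variable [MeasurableSpace E] [BorelSpace E] [MeasurableSpace F] [BorelSpace F]

/-- A surjective linear map is, up to a measure preserving splitting of the source whose slices are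
isometric embeddings of the kernel, a linear automorphism of the target. -/
theorem ContinuousLinearMap.exists_kernel_splitting (L : E →L[ℝ] F) (hL : Function.Surjective L) :
    ∃ (e : F →ₗᵢ[ℝ] E) (T : F ≃L[ℝ] F),
      MeasurePreserving (fun p : F × L.ker => e p.1 + (p.2 : E)) ∧
      (∀ u, L (e u) = T u) ∧
      LinearMap.det (L ∘L adjoint L : F →L[ℝ] F).toLinearMap =
        LinearMap.det (T : F →L[ℝ] F).toLinearMap ^ 2 := by
  set N := L.ker with hN
  have hrank : finrank ℝ F = finrank ℝ Nᗮ := by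
    have h1 := N.finrank_add_finrank_orthogonal
    have h2 := LinearMap.finrank_range_add_finrank_ker L.toLinearMap
    rw [LinearMap.range_eq_top.2 hL, finrank_top] at h2
    have : finrank ℝ L.toLinearMap.ker = finrank ℝ N := rfl
    omega
  let e₀ : F ≃ₗᵢ[ℝ] Nᗮ := ((stdOrthonormalBasis ℝ F).equiv (stdOrthonormalBasis ℝ Nᗮ) (finCongr hrank))
  let e : F →ₗᵢ[ℝ] E := Nᗮ.subtypeₗᵢ.comp e₀.toLinearIsometry
  have he : ∀ u, e u = (e₀ u : E) := fun u => rfl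
  have hinj : Function.Injective (L ∘L e.toContinuousLinearMap) := by
    rw [injective_iff_map_eq_zero]
    intro u hu
    have h1 : e u ∈ N := hu
    have h2 : e u ∈ Nᗮ := (e₀ u).2
    have h3 : e u = 0 := by
      have := Submodule.inner_right_of_mem_orthogonal h1 h2
      exact inner_self_eq_zero.1 this
    exact e.injective (h3.trans e.map_zero.symm)
  let T : F ≃L[ℝ] F := (LinearEquiv.ofInjectiveEndo (L ∘L e.toContinuousLinearMap).toLinearMap
    hinj).toContinuousLinearEquiv
  have hT : ∀ u, L (e u) = T u := fun u => rfl
  -- The range of `L*` is orthogonal to the kernel, so `L* = e T*` and `L L* = T T*`.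
  have hadj : ∀ y, adjoint L y = e (adjoint (T : F →L[ℝ] F) y) := by
    intro y
    refine ext_inner_left ℝ fun x => ?_
    rw [adjoint_inner_right]
    obtain ⟨n, hn, m, hm, rfl⟩ := N.exists_add_mem_mem_orthogonal x
    obtain ⟨u, hu⟩ := e₀.surjective ⟨m, hm⟩
    have hmu : m = e u := by rw [he, hu]
    have hLn : L n = 0 := hn
    have hne : ⟪n, e (adjoint (T : F →L[ℝ] F) y)⟫_ℝ = 0 :=
      Submodule.inner_right_of_mem_orthogonal hn (e₀ _).2
    rw [map_add, hLn, zero_add, inner_add_left, hne, zero_add, hmu, hT, e.inner_map_map,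
      adjoint_inner_right]
    rfl
  refine ⟨e, T, ?_, hT, ?_⟩
  · have h1 : MeasurePreserving (Prod.map e₀ (id : N → N)) :=
      e₀.measurePreserving.prod (MeasurePreserving.id _)
    have h2 : MeasurePreserving (Prod.swap : Nᗮ × N → N × Nᗮ) :=
      Measure.measurePreserving_swap
    have h3 := WithLp.volume_preserving_toLp N Nᗮ
    have h4 := N.orthogonalDecomposition.symm.measurePreserving
    convert! h4.comp (h3.comp (h2.comp h1)) using 1
    ext p
    have : N.orthogonalDecomposition.symm (WithLp.toLp 2 (p.2, e₀ p.1))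
        = (p.2 : E) + (e₀ p.1 : E) := by
      simp
    simp only [Function.comp, Prod.map, id, Prod.swap]
    rw [this, he, add_comm]
  · rw [← ContinuousLinearMap.det_comp_adjoint_self]
    congr 1
    ext y
    simp [hadj, hT]

/-- The coarea formula for a surjective linear map. -/
theorem ContinuousLinearMap.coarea_formula (L : E →L[ℝ] F) (hL : Function.Surjective L) {k : ℕ}
    (hk : finrank ℝ E = finrank ℝ F + k) {s : Set E} (hs : MeasurableSet s) :
    Measurable (fun y => μHE[k] (s ∩ L ⁻¹' {y})) ∧
      ∫⁻ y, μHE[k] (s ∩ L ⁻¹' {y}) =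
        ENNReal.ofReal √(LinearMap.det (L ∘L adjoint L : F →L[ℝ] F).toLinearMap) * volume s := by
  obtain ⟨e, T, hmp, hT, hdet⟩ := L.exists_kernel_splitting hL
  have hkN : finrank ℝ L.ker = k := by
    have h2 := LinearMap.finrank_range_add_finrank_ker L.toLinearMap
    rw [LinearMap.range_eq_top.2 hL, finrank_top] at h2
    have : finrank ℝ L.toLinearMap.ker = finrank ℝ L.ker := rfl
    omega
  set P : F × L.ker → E := fun p => e p.1 + (p.2 : E) with hP
  have hPs : MeasurableSet (P ⁻¹' s) := hmp.measurable hs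
  have hslice : ∀ u, μHE[k] (s ∩ L ⁻¹' {T u}) =
      (volume : Measure L.ker) (Prod.mk u ⁻¹' (P ⁻¹' s)) := by
    intro u
    have hiso : Isometry (fun n : L.ker => P (u, n)) :=
      (IsometryEquiv.addLeft (e u)).isometry.comp isometry_subtype_coe
    rw [← InnerProductSpace.euclideanHausdorffMeasure_eq_volume, hkN,
      ← hiso.euclideanHausdorffMeasure_image]
    congr 1
    ext x
    simp only [mem_inter_iff, mem_preimage, mem_singleton_iff, mem_image]
    constructor
    · rintro ⟨hx, hxu⟩
      have hmem : x - e u ∈ L.ker := by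
        change L (x - e u) = 0
        rw [map_sub, hxu, hT, sub_self]
      exact ⟨⟨x - e u, hmem⟩, by simpa [hP] using hx, by simp [hP]⟩
    · rintro ⟨n, hn, rfl⟩
      have hLn : L (n : E) = 0 := n.2
      exact ⟨hn, by simp [hP, hT, hLn]⟩
  have hmeasT : Measurable fun u => μHE[k] (s ∩ L ⁻¹' {T u}) := by
    simp_rw [hslice]
    exact measurable_measure_prodMk_left hPs
  have hmeas : Measurable fun y => μHE[k] (s ∩ L ⁻¹' {y}) := by
    have := hmeasT.comp T.symm.continuous.measurable
    simpa [Function.comp_def] using this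
  refine ⟨hmeas, ?_⟩
  have hdetT : LinearMap.det (T : F →L[ℝ] F).toLinearMap ≠ 0 :=
    (LinearEquiv.isUnit_det' T.toLinearEquiv).ne_zero
  have hmap := Measure.map_linearMap_addHaar_eq_smul_addHaar (volume : Measure F) hdetT
  have hint : ∫⁻ u, μHE[k] (s ∩ L ⁻¹' {T u}) = volume s := by
    simp_rw [hslice]
    rw [← Measure.prod_apply hPs]
    exact hmp.measure_preimage hs.nullMeasurableSet
  have hmap2 : ∫⁻ u, μHE[k] (s ∩ L ⁻¹' {T u}) =
      ENNReal.ofReal |(LinearMap.det (T : F →L[ℝ] F).toLinearMap)⁻¹| *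
        ∫⁻ y, μHE[k] (s ∩ L ⁻¹' {y}) := by
    rw [← smul_eq_mul, ← lintegral_smul_measure, ← hmap]
    exact (lintegral_map hmeas T.continuous.measurable).symm
  rw [hdet, Real.sqrt_sq_eq_abs, ← hint, hmap2, ← mul_assoc, ← ENNReal.ofReal_mul (abs_nonneg _),
    ← abs_mul, mul_inv_cancel₀ hdetT]
  simp

end LinearCoarea

/-! ### Area measures under bi-Lipschitz maps -/

section EuclideanHausdorff

variable {X Y : Type*} [EMetricSpace X] [MeasurableSpace X] [BorelSpace X]
  [EMetricSpace Y] [MeasurableSpace Y] [BorelSpace Y]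

theorem LipschitzOnWith.euclideanHausdorffMeasure_image_le {K : ℝ≥0} {f : X → Y} {s : Set X}
    (hf : LipschitzOnWith K f s) (k : ℕ) : μHE[k] (f '' s) ≤ (K : ℝ≥0∞) ^ k * μHE[k] s := by
  simp_rw [Measure.euclideanHausdorffMeasure_def, Measure.smul_apply, ENNReal.smul_def, smul_eq_mul]
  have := hf.hausdorffMeasure_image_le (Nat.cast_nonneg k)
  rw [ENNReal.rpow_natCast] at this
  rw [mul_left_comm]
  gcongr

/-- The lower distance bound makes `f` injective on `s` with a `K`-Lipschitz inverse on the image;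
no measurability of `s` is needed. -/
theorem euclideanHausdorffMeasure_le_image {K : ℝ≥0} {f : X → Y} {s : Set X}
    (hf : ∀ x ∈ s, ∀ y ∈ s, edist x y ≤ K * edist (f x) (f y)) (k : ℕ) :
    μHE[k] s ≤ (K : ℝ≥0∞) ^ k * μHE[k] (f '' s) := by
  rcases s.eq_empty_or_nonempty with rfl | ⟨x₀, -⟩
  · simp
  have : Nonempty X := ⟨x₀⟩
  have hinj : InjOn f s := fun x hx y hy hxy => by
    have := hf x hx y hy
    rw [hxy, edist_self, mul_zero] at this
    exact edist_le_zero.1 this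
  have hlip : LipschitzOnWith K (Function.invFunOn f s) (f '' s) := by
    rintro _ ⟨x, hx, rfl⟩ _ ⟨y, hy, rfl⟩
    rw [hinj.leftInvOn_invFunOn hx, hinj.leftInvOn_invFunOn hy]
    exact hf x hx y hy
  have := hlip.euclideanHausdorffMeasure_image_le k
  rwa [hinj.leftInvOn_invFunOn.image_image] at this

end EuclideanHausdorff

/-- The error `1 - K⁻¹` makes one constant serve both directions: the inverse bound is exactly `K`,
the direct one is `2 - K⁻¹ ≤ K`. -/
theorem ApproximatesLinearOn.bilipschitz_of_id {E : Type*} [NormedAddCommGroup E] [NormedSpace ℝ E]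
    {f : E → E} {s : Set E} {K : ℝ≥0} (hK : 1 ≤ K)
    (hf : ApproximatesLinearOn f (ContinuousLinearMap.id ℝ E) s (1 - K⁻¹)) :
    LipschitzOnWith K f s ∧ ∀ x ∈ s, ∀ y ∈ s, edist x y ≤ K * edist (f x) (f y) := by
  have hK0 : (0 : ℝ) < K := by exact_mod_cast zero_lt_one.trans_le hK
  have hK1 : (1 : ℝ) ≤ K := by exact_mod_cast hK
  have hinv : K⁻¹ ≤ 1 := inv_le_one_of_one_le₀ hK
  have happrox : ∀ x ∈ s, ∀ y ∈ s, ‖f x - f y - (x - y)‖ ≤ (1 - (K : ℝ)⁻¹) * ‖x - y‖ := by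
    intro x hx y hy
    have := hf x hx y hy
    rwa [NNReal.coe_sub hinv] at this
  have key : 1 - (K : ℝ)⁻¹ ≤ K - 1 := by
    have : (K : ℝ)⁻¹ * K = 1 := inv_mul_cancel₀ hK0.ne'
    nlinarith [sq_nonneg ((K : ℝ) - 1), inv_pos.2 hK0]
  constructor
  · refine LipschitzOnWith.of_dist_le_mul fun x hx y hy => ?_
    rw [dist_eq_norm, dist_eq_norm]
    have h1 := happrox x hx y hy
    have h2 : ‖f x - f y‖ ≤ ‖f x - f y - (x - y)‖ + ‖x - y‖ := by
      simpa using norm_add_le (f x - f y - (x - y)) (x - y)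
    nlinarith [norm_nonneg (x - y)]
  · intro x hx y hy
    have h1 := happrox x hx y hy
    have h2 : ‖x - y‖ ≤ ‖f x - f y‖ + ‖f x - f y - (x - y)‖ := by
      simpa using norm_sub_le (f x - f y) (f x - f y - (x - y))
    have h3 : (K : ℝ)⁻¹ * ‖x - y‖ ≤ ‖f x - f y‖ := by linarith
    rw [inv_mul_le_iff₀ hK0] at h3
    rw [edist_nndist, edist_nndist]
    have : nndist x y ≤ K * nndist (f x) (f y) := by
      rw [← NNReal.coe_le_coe]
      simpa [dist_eq_norm] using h3
    exact_mod_cast this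

/-! ### The coarea factor and the rank condition -/

section Jacobian

variable {d j : ℕ} {G : EuclideanSpace ℝ (Fin d) → EuclideanSpace ℝ (Fin j)}
  {x : EuclideanSpace ℝ (Fin d)}

theorem jacobianMatrix_eq_toMatrix :
    jacobianMatrix G x = LinearMap.toMatrix (EuclideanSpace.basisFun (Fin d) ℝ).toBasis
      (EuclideanSpace.basisFun (Fin j) ℝ).toBasis (fderiv ℝ G x).toLinearMap := by
  ext i k
  simp [jacobianMatrix, LinearMap.toMatrix_apply]

theorem det_jacobianMatrix_mul_transpose :
    (jacobianMatrix G x * (jacobianMatrix G x).transpose).det =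
      LinearMap.det (fderiv ℝ G x ∘L adjoint (fderiv ℝ G x)).toLinearMap := by
  have h := LinearMap.toMatrix_adjoint (EuclideanSpace.basisFun (Fin d) ℝ)
    (EuclideanSpace.basisFun (Fin j) ℝ) (fderiv ℝ G x).toLinearMap
  have h2 : (adjoint (fderiv ℝ G x)).toLinearMap = LinearMap.adjoint (fderiv ℝ G x).toLinearMap :=
    rfl
  rw [← LinearMap.det_toMatrix (EuclideanSpace.basisFun (Fin j) ℝ).toBasis, toLinearMap_comp,
    LinearMap.toMatrix_comp _ (EuclideanSpace.basisFun (Fin d) ℝ).toBasis, h2, h,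
    Matrix.conjTranspose_eq_transpose_of_trivial, jacobianMatrix_eq_toMatrix]

theorem coareaFactor_eq : coareaFactor G x =
    √(LinearMap.det (fderiv ℝ G x ∘L adjoint (fderiv ℝ G x)).toLinearMap) := by
  rw [coareaFactor, det_jacobianMatrix_mul_transpose]

theorem rank_jacobianMatrix :
    (jacobianMatrix G x).rank = finrank ℝ (fderiv ℝ G x).toLinearMap.range := by
  rw [jacobianMatrix_eq_toMatrix, Matrix.rank_eq_finrank_range_toLin _
    (EuclideanSpace.basisFun (Fin j) ℝ).toBasis (EuclideanSpace.basisFun (Fin d) ℝ).toBasis,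
    Matrix.toLin_toMatrix]

theorem rank_jacobianMatrix_eq_iff :
    (jacobianMatrix G x).rank = j ↔ Function.Surjective (fderiv ℝ G x) := by
  rw [rank_jacobianMatrix]
  constructor
  · intro h
    have : (fderiv ℝ G x).toLinearMap.range = ⊤ :=
      Submodule.eq_top_of_finrank_eq (by rw [h, finrank_euclideanSpace_fin])
    exact LinearMap.range_eq_top.1 this
  · intro h
    rw [LinearMap.range_eq_top.2 h, finrank_top, finrank_euclideanSpace_fin]

theorem coareaFactor_pos (h : Function.Surjective (fderiv ℝ G x)) : 0 < coareaFactor G x := by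
  obtain ⟨-, T, -, -, hdet⟩ := (fderiv ℝ G x).exists_kernel_splitting h
  rw [coareaFactor_eq, hdet, Real.sqrt_pos]
  have : LinearMap.det (T : EuclideanSpace ℝ (Fin j) →L[ℝ] _).toLinearMap ≠ 0 :=
    (LinearEquiv.isUnit_det' T.toLinearEquiv).ne_zero
  positivity

theorem coareaFactor_eq_zero (h : (jacobianMatrix G x).rank ≠ j) : coareaFactor G x = 0 := by
  rw [coareaFactor, Real.sqrt_eq_zero']
  by_contra! hpos
  apply h
  rw [← Matrix.rank_self_mul_transpose, Matrix.rank_of_det_ne_zero hpos.ne', Fintype.card_fin]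

theorem coareaFactor_pos_iff : 0 < coareaFactor G x ↔ (jacobianMatrix G x).rank = j :=
  ⟨fun h => by_contra fun h' => h.ne' (coareaFactor_eq_zero h'),
    fun h => coareaFactor_pos (rank_jacobianMatrix_eq_iff.1 h)⟩

/-- No regularity of `G` is required: directional values of `fderiv` are Borel for every map. -/
theorem measurable_coareaFactor : Measurable (coareaFactor G) := by
  have h : ∀ i k, Measurable fun x => jacobianMatrix G x i k := fun i k =>
    (EuclideanSpace.proj (𝕜 := ℝ) i).continuous.measurable.comp
      (measurable_fderiv_apply_const ℝ G (EuclideanSpace.single k 1))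
  have hM : Measurable fun x => (fun i k => jacobianMatrix G x i k : Fin j → Fin d → ℝ) :=
    measurable_pi_lambda _ fun i => measurable_pi_lambda _ fun k => h i k
  have hc : Continuous fun M : Fin j → Fin d → ℝ =>
      √(Matrix.of M * (Matrix.of M).transpose).det := by fun_prop
  exact hc.measurable.comp hM

theorem continuousAt_coareaFactor (hG : ContDiffAt ℝ 1 G x) :
    ContinuousAt (coareaFactor G) x := by
  have hf : ContinuousAt (fderiv ℝ G) x := (hG.fderiv_right (m := 0) (by norm_num)).continuousAt
  have hM : ContinuousAt (fun x => (jacobianMatrix G x : Matrix (Fin j) (Fin d) ℝ)) x :=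
    continuousAt_pi.2 fun i => continuousAt_pi.2 fun k =>
      (EuclideanSpace.proj (𝕜 := ℝ) i).continuous.continuousAt.comp
        (hf.clm_apply continuousAt_const)
  have hc : Continuous fun M : Matrix (Fin j) (Fin d) ℝ => √(M * M.transpose).det := by fun_prop
  exact hc.continuousAt.comp hM

end Jacobian

/-! ### The local estimate -/

/-- Near a regular point, the coarea formula holds up to a factor close to `1`. -/
theorem exists_nhds_coarea_approx {d j k : ℕ} (hk : d = j + k)
    {G : EuclideanSpace ℝ (Fin d) → EuclideanSpace ℝ (Fin j)} {x₀ : EuclideanSpace ℝ (Fin d)}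
    (hG : ContDiffAt ℝ 1 G x₀) (hx₀ : Function.Surjective (fderiv ℝ G x₀))
    {t : ℝ≥0} (ht : 1 < t) :
    ∃ U ∈ 𝓝 x₀, ∀ s ⊆ U, MeasurableSet s → ∃ a : EuclideanSpace ℝ (Fin j) → ℝ≥0∞,
      Measurable a ∧ (∀ y, μHE[k] (s ∩ G ⁻¹' {y}) ≤ t * a y) ∧
      (∀ y, a y ≤ t * μHE[k] (s ∩ G ⁻¹' {y})) ∧
      ∫⁻ y, a y ≤ t * ∫⁻ x in s, ENNReal.ofReal (coareaFactor G x) ∧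
      ∫⁻ x in s, ENNReal.ofReal (coareaFactor G x) ≤ t * ∫⁻ y, a y := by
  -- Volumes cost `K ^ d`, the oscillation of the coarea factor one more `K`, and slices only `K ^
  -- k` with `k ≤ d`.
  obtain ⟨K, hK1, hKt⟩ : ∃ K : ℝ≥0, 1 < K ∧ K ^ (d + 1) = t :=
    ⟨t ^ (((d + 1 : ℕ) : ℝ)⁻¹), NNReal.one_lt_rpow ht (by positivity),
      NNReal.rpow_inv_natCast_pow t (by omega)⟩
  have hpow : ∀ {m : ℕ}, m ≤ d + 1 → (K : ℝ≥0∞) ^ m ≤ t := fun {m} hm => by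
    rw [← hKt]
    exact_mod_cast pow_le_pow_right₀ hK1.le hm
  set A := fderiv ℝ G x₀ with hA
  obtain ⟨R₀, hR₀⟩ := A.toLinearMap.exists_rightInverse_of_surjective (LinearMap.range_eq_top.2 hx₀)
  let R := R₀.toContinuousLinearMap
  have hR : ∀ y, A (R y) = y := fun y => LinearMap.congr_fun hR₀ y
  -- Adding a right inverse of `A` applied to the nonlinear error gives `A ∘ F = G` everywhere, not
  -- only to first order.
  let F : EuclideanSpace ℝ (Fin d) → EuclideanSpace ℝ (Fin d) := fun x => x + R (G x - A x)
  have hAF : ∀ x, A (F x) = G x := fun x => by simp [F, hR]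
  have hF : HasStrictFDerivAt F (ContinuousLinearMap.id ℝ _) x₀ := by
    have h1 : HasStrictFDerivAt G A x₀ := hG.hasStrictFDerivAt (by norm_num)
    have h2 := (hasStrictFDerivAt_id x₀).add
      ((R.hasStrictFDerivAt (x := G x₀ - A x₀)).comp x₀ (h1.sub A.hasStrictFDerivAt))
    convert! h2 using 1
    simp
  have hδ : 0 < 1 - K⁻¹ := tsub_pos_of_lt (inv_lt_one_of_one_lt₀ hK1)
  obtain ⟨V, hV, hFV⟩ := hF.approximates_deriv_on_nhds (Or.inr hδ)
  obtain ⟨hlip, hanti⟩ := hFV.bilipschitz_of_id hK1.le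
  set J₀ := coareaFactor G x₀ with hJ₀
  have hJpos : 0 < J₀ := coareaFactor_pos hx₀
  have hJcont := continuousAt_coareaFactor hG
  have hK1' : (1 : ℝ) < K := by exact_mod_cast hK1
  have hJ1 : ∀ᶠ x in 𝓝 x₀, coareaFactor G x < K * J₀ :=
    hJcont.eventually_lt continuousAt_const (lt_mul_of_one_lt_left hJpos hK1')
  have hJ2 : ∀ᶠ x in 𝓝 x₀, J₀ < K * coareaFactor G x :=
    continuousAt_const.eventually_lt (continuousAt_const.mul hJcont)
      (lt_mul_of_one_lt_left hJpos hK1')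
  refine ⟨V ∩ ({x | coareaFactor G x < K * J₀} ∩ {x | J₀ < K * coareaFactor G x}),
    inter_mem hV (inter_mem hJ1 hJ2), fun s hs hsm => ?_⟩
  have hsV : s ⊆ V := fun x hx => (hs hx).1
  have hinj : InjOn F s := fun x hx y hy hxy => by
    have := hanti x (hsV hx) y (hsV hy)
    rw [hxy, edist_self, mul_zero] at this
    exact edist_le_zero.1 this
  -- Injective continuous images of Borel sets are Borel (Lusin–Souslin).
  have hFs : MeasurableSet (F '' s) :=
    hsm.image_of_continuousOn_injOn (hlip.continuousOn.mono hsV) hinj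
  have hslice : ∀ y, F '' (s ∩ G ⁻¹' {y}) = F '' s ∩ A ⁻¹' {y} := by
    intro y
    ext z
    constructor
    · rintro ⟨x, ⟨hx, hxy⟩, rfl⟩
      exact ⟨⟨x, hx, rfl⟩, (hAF x).trans hxy⟩
    · rintro ⟨⟨x, hx, rfl⟩, hz⟩
      exact ⟨x, ⟨hx, (hAF x).symm.trans hz⟩, rfl⟩
  obtain ⟨hmeas, hint⟩ := A.coarea_formula hx₀ (k := k) (by simpa using hk) hFs
  rw [← coareaFactor_eq, ← hJ₀] at hint
  have hvol1 : volume (F '' s) ≤ (K : ℝ≥0∞) ^ d * volume s := by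
    rw [← EuclideanSpace.euclideanHausdorffMeasure_eq_volume]
    exact (hlip.mono hsV).euclideanHausdorffMeasure_image_le d
  have hvol2 : volume s ≤ (K : ℝ≥0∞) ^ d * volume (F '' s) := by
    rw [← EuclideanSpace.euclideanHausdorffMeasure_eq_volume]
    exact euclideanHausdorffMeasure_le_image (fun x hx y hy => hanti x (hsV hx) y (hsV hy)) d
  have hJK : ∀ {a b : ℝ}, a ≤ K * b → ENNReal.ofReal a ≤ K * ENNReal.ofReal b := fun {a b} h => by
    calc ENNReal.ofReal a ≤ ENNReal.ofReal (K * b) := ENNReal.ofReal_le_ofReal h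
      _ = K * ENNReal.ofReal b := by
        rw [ENNReal.ofReal_mul K.coe_nonneg, ENNReal.ofReal_coe_nnreal]
  have hI1 : ENNReal.ofReal J₀ * volume s ≤
      K * ∫⁻ x in s, ENNReal.ofReal (coareaFactor G x) := by
    rw [← setLIntegral_const, ← lintegral_const_mul' _ _ ENNReal.coe_ne_top]
    exact setLIntegral_mono' hsm fun x hx => hJK (hs hx).2.2.le
  have hI2 : ∫⁻ x in s, ENNReal.ofReal (coareaFactor G x) ≤
      K * (ENNReal.ofReal J₀ * volume s) := by
    rw [← setLIntegral_const, ← lintegral_const_mul' _ _ ENNReal.coe_ne_top]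
    exact setLIntegral_mono' hsm fun x hx => hJK (hs hx).2.1.le
  -- The comparison function is the slice measure of the straightened set, measurable by the linear
  -- case.
  refine ⟨fun y => μHE[k] (F '' s ∩ A ⁻¹' {y}), hmeas, fun y => ?_, fun y => ?_, ?_, ?_⟩
  · simp only [← hslice]
    refine (euclideanHausdorffMeasure_le_image (K := K) (f := F) (fun x hx y hy =>
      hanti x (hsV hx.1) y (hsV hy.1)) k).trans ?_
    gcongr
    exact hpow (by omega)
  · simp only [← hslice]
    refine ((hlip.mono fun x hx => hsV hx.1).euclideanHausdorffMeasure_image_le k).trans ?_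
    gcongr
    exact hpow (by omega)
  · rw [hint]
    calc ENNReal.ofReal J₀ * volume (F '' s)
        ≤ ENNReal.ofReal J₀ * ((K : ℝ≥0∞) ^ d * volume s) := by gcongr
      _ = (K : ℝ≥0∞) ^ d * (ENNReal.ofReal J₀ * volume s) := by ring
      _ ≤ (K : ℝ≥0∞) ^ d * (K * ∫⁻ x in s, ENNReal.ofReal (coareaFactor G x)) := by gcongr
      _ = (K : ℝ≥0∞) ^ (d + 1) * ∫⁻ x in s, ENNReal.ofReal (coareaFactor G x) := by ring
      _ ≤ _ := by gcongr; exact hpow le_rfl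
  · rw [hint]
    calc ∫⁻ x in s, ENNReal.ofReal (coareaFactor G x)
        ≤ K * (ENNReal.ofReal J₀ * ((K : ℝ≥0∞) ^ d * volume (F '' s))) :=
          hI2.trans (by gcongr)
      _ = (K : ℝ≥0∞) ^ (d + 1) * (ENNReal.ofReal J₀ * volume (F '' s)) := by ring
      _ ≤ _ := by gcongr; exact hpow le_rfl

/-! ### From local estimates to the regular set -/

section Coarea

variable {d j k : ℕ} {D : Set (EuclideanSpace ℝ (Fin d))}
  {G : EuclideanSpace ℝ (Fin d) → EuclideanSpace ℝ (Fin j)}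

theorem measurable_indicator_of_contDiffOn (hD : IsOpen D) (hG : ContDiffOn ℝ 1 G D) :
    Measurable (D.indicator G) := by
  classical
  rw [← piecewise_eq_indicator]
  exact hG.continuousOn.measurable_piecewise continuousOn_const hD.measurableSet

theorem measurableSet_inter_fiber (hD : IsOpen D) (hG : ContDiffOn ℝ 1 G D)
    {s : Set (EuclideanSpace ℝ (Fin d))} (hs : MeasurableSet s) (hsD : s ⊆ D)
    (y : EuclideanSpace ℝ (Fin j)) : MeasurableSet (s ∩ G ⁻¹' {y}) := by
  have : s ∩ G ⁻¹' {y} = s ∩ D.indicator G ⁻¹' {y} := by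
    ext x
    refine and_congr_right fun hx => ?_
    simp [indicator_of_mem (hsD hx)]
  rw [this]
  exact hs.inter (measurable_indicator_of_contDiffOn hD hG (measurableSet_singleton y))

theorem measurableSet_regularSet (hD : IsOpen D) : MeasurableSet (regularSet D G) := by
  have : regularSet D G = D ∩ coareaFactor G ⁻¹' Ioi 0 := by
    ext x
    exact and_congr_right fun _ => coareaFactor_pos_iff.symm
  rw [this]
  exact hD.measurableSet.inter (measurable_coareaFactor measurableSet_Ioi)

/-- On the regular set, the coarea formula holds up to a factor arbitrarily close to `1`. -/
theorem coarea_approx (hk : d = j + k) (hD : IsOpen D) (hG : ContDiffOn ℝ 1 G D)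
    {s : Set (EuclideanSpace ℝ (Fin d))} (hs : MeasurableSet s) (hsD : s ⊆ regularSet D G)
    {t : ℝ≥0} (ht : 1 < t) :
    ∃ a : EuclideanSpace ℝ (Fin j) → ℝ≥0∞,
      Measurable a ∧ (∀ y, μHE[k] (s ∩ G ⁻¹' {y}) ≤ t * a y) ∧
      (∀ y, a y ≤ t * μHE[k] (s ∩ G ⁻¹' {y})) ∧
      ∫⁻ y, a y ≤ t * ∫⁻ x in s, ENNReal.ofReal (coareaFactor G x) ∧
      ∫⁻ x in s, ENNReal.ofReal (coareaFactor G x) ≤ t * ∫⁻ y, a y := by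
  have hloc : ∀ x : EuclideanSpace ℝ (Fin d), ∃ U : Set (EuclideanSpace ℝ (Fin d)), IsOpen U ∧
      (x ∈ regularSet D G → x ∈ U) ∧
      ∀ s ⊆ U, MeasurableSet s → ∃ a : EuclideanSpace ℝ (Fin j) → ℝ≥0∞,
      Measurable a ∧ (∀ y, μHE[k] (s ∩ G ⁻¹' {y}) ≤ t * a y) ∧
      (∀ y, a y ≤ t * μHE[k] (s ∩ G ⁻¹' {y})) ∧
      ∫⁻ y, a y ≤ t * ∫⁻ x in s, ENNReal.ofReal (coareaFactor G x) ∧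
      ∫⁻ x in s, ENNReal.ofReal (coareaFactor G x) ≤ t * ∫⁻ y, a y := by
    intro x
    by_cases hx : x ∈ regularSet D G
    · obtain ⟨U, hU, h⟩ := exists_nhds_coarea_approx hk (hG.contDiffAt (hD.mem_nhds hx.1))
        (rank_jacobianMatrix_eq_iff.1 hx.2) ht
      obtain ⟨V, hVU, hV, hxV⟩ := mem_nhds_iff.1 hU
      exact ⟨V, hV, fun _ => hxV, fun s hs => h s (hs.trans hVU)⟩
    · refine ⟨∅, isOpen_empty, fun h => (hx h).elim, fun s hs _ => ⟨0, measurable_zero, ?_⟩⟩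
      simp [subset_empty_iff.1 hs]
  choose U hUo hxU hU using hloc
  obtain ⟨T, -, hTc, hTs⟩ := TopologicalSpace.countable_cover_nhdsWithin
    (f := U) (s := regularSet D G) fun x hx => mem_nhdsWithin_of_mem_nhds ((hUo x).mem_nhds (hxU x hx))
  -- Inserting `0` makes the index set nonempty, hence enumerable by `ℕ`; the estimate holds on `U
  -- 0` in any case.
  have hT' : (insert 0 T).Countable := hTc.insert 0
  obtain ⟨u, hu⟩ := hT'.exists_eq_range (insert_nonempty 0 T)
  let p : ℕ → Set (EuclideanSpace ℝ (Fin d)) := fun n => s ∩ disjointed (fun n => U (u n)) n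
  have hpm : ∀ n, MeasurableSet (p n) := fun n =>
    hs.inter (MeasurableSet.disjointed (fun n => (hUo (u n)).measurableSet) n)
  have hpU : ∀ n, p n ⊆ U (u n) := fun n => inter_subset_right.trans (disjointed_subset _ n)
  have hpd : Pairwise (Function.onFun Disjoint p) := fun m n hmn =>
    (disjoint_disjointed _ hmn).mono inter_subset_right inter_subset_right
  have hps : ⋃ n, p n = s := by
    rw [← inter_iUnion, iUnion_disjointed, inter_eq_left]
    intro x hx
    obtain ⟨z, hz, hxz⟩ := mem_iUnion₂.1 (hTs (hsD hx))
    have hz' : z ∈ range u := hu ▸ mem_insert_of_mem 0 hz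
    obtain ⟨n, rfl⟩ := hz'
    exact mem_iUnion.2 ⟨n, hxz⟩
  choose a ha h1 h2 h3 h4 using fun n => hU (u n) (p n) (hpU n) (hpm n)
  have hsum : ∀ y, μHE[k] (s ∩ G ⁻¹' {y}) = ∑' n, μHE[k] (p n ∩ G ⁻¹' {y}) := by
    intro y
    rw [← measure_iUnion (fun m n hmn => (hpd hmn).mono inter_subset_left inter_subset_left)
      fun n => measurableSet_inter_fiber hD hG (hpm n)
        (inter_subset_left.trans (hsD.trans fun x hx => hx.1)) y, ← iUnion_inter, hps]
  have hint : ∫⁻ x in s, ENNReal.ofReal (coareaFactor G x) =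
      ∑' n, ∫⁻ x in p n, ENNReal.ofReal (coareaFactor G x) := by
    rw [← lintegral_iUnion hpm hpd, hps]
  refine ⟨fun y => ∑' n, a n y, Measurable.tsum ha, fun y => ?_, fun y => ?_, ?_, ?_⟩
  · rw [hsum, ← ENNReal.tsum_mul_left]
    exact ENNReal.tsum_le_tsum fun n => h1 n y
  · rw [hsum, ← ENNReal.tsum_mul_left]
    exact ENNReal.tsum_le_tsum fun n => h2 n y
  · rw [hint, lintegral_tsum fun n => (ha n).aemeasurable, ← ENNReal.tsum_mul_left]
    exact ENNReal.tsum_le_tsum h3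
  · rw [hint, lintegral_tsum fun n => (ha n).aemeasurable, ← ENNReal.tsum_mul_left]
    exact ENNReal.tsum_le_tsum h4

/-- Squeezing between `b / t n` and `t n * b` also covers `b = ∞`. -/
theorem ENNReal.tendsto_of_le_mul {a t : ℕ → ℝ≥0∞} {b : ℝ≥0∞} (ht : Tendsto t atTop (𝓝 1))
    (h1 : ∀ n, b ≤ t n * a n) (h2 : ∀ n, a n ≤ t n * b) : Tendsto a atTop (𝓝 b) := by
  have hl : Tendsto (fun n => (t n)⁻¹ * b) atTop (𝓝 b) := by
    have := ENNReal.Tendsto.mul_const (b := b) (tendsto_inv_iff.2 ht) (Or.inl (by simp))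
    simpa using this
  have hr : Tendsto (fun n => t n * b) atTop (𝓝 b) := by
    simpa using ENNReal.Tendsto.mul_const (b := b) ht (Or.inl one_ne_zero)
  refine tendsto_of_tendsto_of_tendsto_of_le_of_le hl hr (fun n => ?_) h2
  rw [mul_comm, ← div_eq_mul_inv]
  exact ENNReal.div_le_of_le_mul' (h1 n)

/-- The coarea formula for a Borel subset of the regular set. -/
theorem coarea_measure (hk : d = j + k) (hD : IsOpen D) (hG : ContDiffOn ℝ 1 G D)
    {s : Set (EuclideanSpace ℝ (Fin d))} (hs : MeasurableSet s) (hsD : s ⊆ regularSet D G) :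
    Measurable (fun y => μHE[k] (s ∩ G ⁻¹' {y})) ∧
      ∫⁻ y, μHE[k] (s ∩ G ⁻¹' {y}) = ∫⁻ x in s, ENNReal.ofReal (coareaFactor G x) := by
  let t : ℕ → ℝ≥0 := fun n => 1 + 1 / (n + 1)
  have ht1 : ∀ n, 1 < t n := fun n => lt_add_of_pos_right 1 (by positivity)
  have ht : Tendsto (fun n => (t n : ℝ≥0∞)) atTop (𝓝 1) := by
    rw [← ENNReal.coe_one, ENNReal.tendsto_coe]
    simpa [t] using (tendsto_one_div_add_atTop_nhds_zero_nat (𝕜 := ℝ≥0)).const_add 1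
  choose a ha h1 h2 h3 h4 using fun n => coarea_approx hk hD hG hs hsD (ht1 n)
  have hmeas : Measurable (fun y => μHE[k] (s ∩ G ⁻¹' {y})) :=
    measurable_of_tendsto_metrizable ha (tendsto_pi_nhds.2 fun y =>
      ENNReal.tendsto_of_le_mul ht (fun n => h1 n y) fun n => h2 n y)
  -- Both sides are limits of the same integrals `∫⁻ y, a n y`.
  refine ⟨hmeas, tendsto_nhds_unique (f := fun n => ∫⁻ y, a n y) (l := atTop) ?_
    (ENNReal.tendsto_of_le_mul ht h4 h3)⟩
  refine ENNReal.tendsto_of_le_mul ht (fun n => ?_) fun n => ?_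
  · rw [← lintegral_const_mul _ (ha n)]
    exact lintegral_mono (h1 n)
  · rw [← lintegral_const_mul _ hmeas]
    exact lintegral_mono (h2 n)

end Coarea

/-- Positive and negative parts reduce this to the nonnegative case; finiteness of the total makes
almost every fibre integral finite, so the subtraction is legitimate. -/
theorem MeasureTheory.Measure.integral_bind_of_lintegral_lt_top {α β : Type*} [MeasurableSpace α]
    [MeasurableSpace β] {m : Measure α} {κ : α → Measure β} (hκ : Measurable κ) {f : β → ℝ}
    (hf : Measurable f) (hfin : ∫⁻ x, ‖f x‖ₑ ∂(m.bind κ) < ⊤) :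
    (∀ᵐ y ∂m, Integrable f (κ y)) ∧ Integrable (fun y => ∫ x, f x ∂(κ y)) m ∧
      ∫ x, f x ∂(m.bind κ) = ∫ y, ∫ x, f x ∂(κ y) ∂m := by
  have hint : Integrable f (m.bind κ) := ⟨hf.aestronglyMeasurable, hfin⟩
  have key : ∀ g : β → ℝ≥0∞, Measurable g → (∀ x, g x ≤ ‖f x‖ₑ) →
      Integrable (fun y => (∫⁻ x, g x ∂(κ y)).toReal) m ∧
        ∫ y, (∫⁻ x, g x ∂(κ y)).toReal ∂m = (∫⁻ x, g x ∂(m.bind κ)).toReal := by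
    intro g hg hgf
    have hm : Measurable fun y => ∫⁻ x, g x ∂(κ y) := (Measure.measurable_lintegral hg).comp hκ
    have hlt : ∫⁻ y, ∫⁻ x, g x ∂(κ y) ∂m < ⊤ := by
      rw [← Measure.lintegral_bind hκ.aemeasurable hg.aemeasurable]
      exact (lintegral_mono hgf).trans_lt hfin
    refine ⟨integrable_toReal_of_lintegral_ne_top hm.aemeasurable hlt.ne, ?_⟩
    rw [integral_toReal hm.aemeasurable (ae_lt_top hm hlt.ne),
      Measure.lintegral_bind hκ.aemeasurable hg.aemeasurable]
  have hae : ∀ᵐ y ∂m, Integrable f (κ y) := by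
    have hm : Measurable fun y => ∫⁻ x, ‖f x‖ₑ ∂(κ y) :=
      (Measure.measurable_lintegral hf.enorm).comp hκ
    rw [Measure.lintegral_bind hκ.aemeasurable hf.enorm.aemeasurable] at hfin
    filter_upwards [ae_lt_top hm hfin.ne] with y hy
    exact ⟨hf.aestronglyMeasurable, hy⟩
  obtain ⟨hp, hp'⟩ := key (fun x => ENNReal.ofReal (f x)) hf.ennreal_ofReal
    fun x => by rw [← ofReal_norm]; exact ENNReal.ofReal_le_ofReal (le_abs_self _)
  obtain ⟨hn, hn'⟩ := key (fun x => ENNReal.ofReal (-f x)) hf.neg.ennreal_ofReal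
    fun x => by rw [← ofReal_norm]; exact ENNReal.ofReal_le_ofReal (neg_le_abs _)
  have heq : (fun y => ∫ x, f x ∂(κ y)) =ᵐ[m] fun y =>
      (∫⁻ x, ENNReal.ofReal (f x) ∂(κ y)).toReal - (∫⁻ x, ENNReal.ofReal (-f x) ∂(κ y)).toReal := by
    filter_upwards [hae] with y hy
    exact integral_eq_lintegral_pos_part_sub_lintegral_neg_part hy
  refine ⟨hae, (hp.sub hn).congr heq.symm, ?_⟩
  rw [integral_congr_ae heq, integral_sub hp hn, hp', hn',
    integral_eq_lintegral_pos_part_sub_lintegral_neg_part hint]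

/-! ### Disintegration over regular level sets -/

section Disintegration

variable {d j : ℕ} {D : Set (EuclideanSpace ℝ (Fin d))}
  {G : EuclideanSpace ℝ (Fin d) → EuclideanSpace ℝ (Fin j)} {B : Set (EuclideanSpace ℝ (Fin d))}

theorem regularLevelSet_eq (y : EuclideanSpace ℝ (Fin j)) :
    regularLevelSet D G B y = B ∩ regularSet D G ∩ G ⁻¹' {y} := by
  ext x
  simp only [regularLevelSet, levelSet, regularSet, mem_inter_iff, mem_ofPred_eq, mem_preimage,
    mem_singleton_iff]
  tauto

theorem measurableSet_regularLevelSet (hD : IsOpen D) (hG : ContDiffOn ℝ 1 G D)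
    (hB : MeasurableSet B) (y : EuclideanSpace ℝ (Fin j)) :
    MeasurableSet (regularLevelSet D G B y) := by
  rw [regularLevelSet_eq]
  exact measurableSet_inter_fiber hD hG (hB.inter (measurableSet_regularSet hD))
    (fun x hx => hx.2.1) y

theorem coarea_slice (hjd : j ≤ d) (hD : IsOpen D) (hG : ContDiffOn ℝ 1 G D)
    (hB : MeasurableSet B) {s : Set (EuclideanSpace ℝ (Fin d))} (hs : MeasurableSet s) :
    Measurable (fun y => (areaMeasure d (d - j)).restrict (regularLevelSet D G B y) s) ∧
      ∫⁻ y, (areaMeasure d (d - j)).restrict (regularLevelSet D G B y) s =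
        ∫⁻ x in s ∩ (B ∩ regularSet D G), ENNReal.ofReal (coareaFactor G x) := by
  have h := coarea_measure (k := d - j) (by omega) hD hG
    (hs.inter (hB.inter (measurableSet_regularSet hD))) fun x hx => hx.2.2
  simpa only [Measure.restrict_apply hs, areaMeasure, regularLevelSet_eq, inter_assoc] using h

theorem measurable_restrict_regularLevelSet (hjd : j ≤ d) (hD : IsOpen D)
    (hG : ContDiffOn ℝ 1 G D) (hB : MeasurableSet B) :
    Measurable fun y => (areaMeasure d (d - j)).restrict (regularLevelSet D G B y) :=
  Measure.measurable_of_measurable_coe _ fun _ hs => (coarea_slice hjd hD hG hB hs).1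

/-- Disintegration of the measure with density the coarea factor over the regular level sets. -/
theorem bind_restrict_regularLevelSet (hjd : j ≤ d) (hD : IsOpen D) (hG : ContDiffOn ℝ 1 G D)
    (hB : MeasurableSet B) (hBD : B ⊆ D) :
    (volume : Measure (EuclideanSpace ℝ (Fin j))).bind
        (fun y => (areaMeasure d (d - j)).restrict (regularLevelSet D G B y)) =
      (volume.restrict B).withDensity fun x => ENNReal.ofReal (coareaFactor G x) := by
  ext s hs
  rw [Measure.bind_apply hs (measurable_restrict_regularLevelSet hjd hD hG hB).aemeasurable,
    (coarea_slice hjd hD hG hB hs).2, withDensity_apply _ hs, Measure.restrict_restrict hs]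
  rw [← lintegral_inter_add_sdiff _ (s ∩ B) (measurableSet_regularSet hD), inter_assoc,
    setLIntegral_eq_zero ((hs.inter hB).diff (measurableSet_regularSet hD)), add_zero]
  intro x hx
  have : (jacobianMatrix G x).rank ≠ j := fun h => hx.2 ⟨hBD hx.1.2, h⟩
  simp [coareaFactor_eq_zero this]

theorem lintegral_coarea (hjd : j ≤ d) (hD : IsOpen D) (hG : ContDiffOn ℝ 1 G D)
    (hB : MeasurableSet B) (hBD : B ⊆ D)
    {h : EuclideanSpace ℝ (Fin d) × EuclideanSpace ℝ (Fin j) → ℝ≥0∞} (hh : Measurable h) :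
    Measurable
        (fun y => ∫⁻ x in regularLevelSet D G B y, h (x, y) ∂(areaMeasure d (d - j))) ∧
      ∫⁻ x in B, h (x, G x) * ENNReal.ofReal (coareaFactor G x) =
        ∫⁻ y, ∫⁻ x in regularLevelSet D G B y, h (x, y) ∂(areaMeasure d (d - j)) := by
  have hκ := measurable_restrict_regularLevelSet hjd hD hG hB
  -- `G` is arbitrary off `D`; extending it by `0` gives a Borel function that agrees with it on `B`
  -- and on every fibre.
  have hg : Measurable fun x => h (x, D.indicator G x) :=
    hh.comp (measurable_id.prodMk (measurable_indicator_of_contDiffOn hD hG))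
  have hC : ∀ y, ∫⁻ x in regularLevelSet D G B y, h (x, y) ∂(areaMeasure d (d - j)) =
      ∫⁻ x in regularLevelSet D G B y, h (x, D.indicator G x) ∂(areaMeasure d (d - j)) := fun y =>
    setLIntegral_congr_fun (measurableSet_regularLevelSet hD hG hB y) fun x hx => by
      simp only [indicator_of_mem hx.1.1.1, hx.1.1.2]
  simp_rw [hC]
  refine ⟨(Measure.measurable_lintegral hg).comp hκ, ?_⟩
  rw [← Measure.lintegral_bind hκ.aemeasurable hg.aemeasurable,
    bind_restrict_regularLevelSet hjd hD hG hB hBD,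
    lintegral_withDensity_eq_lintegral_mul _ measurable_coareaFactor.ennreal_ofReal hg]
  refine setLIntegral_congr_fun hB fun x hx => ?_
  simp only [Pi.mul_apply, indicator_of_mem (hBD hx), mul_comm]

theorem integral_coarea (hjd : j ≤ d) (hD : IsOpen D) (hG : ContDiffOn ℝ 1 G D)
    (hB : MeasurableSet B) (hBD : B ⊆ D)
    {h : EuclideanSpace ℝ (Fin d) × EuclideanSpace ℝ (Fin j) → ℝ} (hh : Measurable h)
    (hfin : ((∫⁻ x in B, ‖h (x, G x)‖ₑ * ENNReal.ofReal (coareaFactor G x)) < ⊤ ∨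
      (∫⁻ y, ∫⁻ x in regularLevelSet D G B y, ‖h (x, y)‖ₑ ∂(areaMeasure d (d - j))) < ⊤)) :
    IntegrableOn (fun x => h (x, G x) * coareaFactor G x) B volume ∧
      (∀ᵐ y, IntegrableOn (fun x => h (x, y)) (regularLevelSet D G B y)
        (areaMeasure d (d - j))) ∧
      Integrable
        (fun y => ∫ x in regularLevelSet D G B y, h (x, y) ∂(areaMeasure d (d - j))) volume ∧
      ∫ x in B, h (x, G x) * coareaFactor G x =
        ∫ y, ∫ x in regularLevelSet D G B y, h (x, y) ∂(areaMeasure d (d - j)) := by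
  -- By the nonnegative formula the two finiteness conditions coincide.
  rw [← (lintegral_coarea hjd hD hG hB hBD hh.enorm).2, or_self] at hfin
  have hκ := measurable_restrict_regularLevelSet hjd hD hG hB
  have hJ : Measurable fun x => ENNReal.ofReal (coareaFactor G x) :=
    measurable_coareaFactor.ennreal_ofReal
  have hg : Measurable fun x => h (x, D.indicator G x) :=
    hh.comp (measurable_id.prodMk (measurable_indicator_of_contDiffOn hD hG))
  have hC : ∀ y, EqOn (fun x => h (x, D.indicator G x)) (fun x => h (x, y))
      (regularLevelSet D G B y) := fun y x hx => by
    simp only [indicator_of_mem hx.1.1.1, hx.1.1.2]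
  have hCm := measurableSet_regularLevelSet hD hG hB
  have hBeq : EqOn (fun x => (ENNReal.ofReal (coareaFactor G x)).toReal • h (x, D.indicator G x))
      (fun x => h (x, G x) * coareaFactor G x) B := fun x hx => by
    simp only [indicator_of_mem (hBD hx), smul_eq_mul, coareaFactor,
      ENNReal.toReal_ofReal (Real.sqrt_nonneg _), mul_comm]
  have hbind := bind_restrict_regularLevelSet hjd hD hG hB hBD
  have hfin' : ∫⁻ x, ‖h (x, D.indicator G x)‖ₑ ∂((volume.restrict B).withDensity
      fun x => ENNReal.ofReal (coareaFactor G x)) < ⊤ := by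
    rw [lintegral_withDensity_eq_lintegral_mul _ hJ hg.enorm]
    refine (setLIntegral_congr_fun hB fun x hx => ?_).trans_lt hfin
    simp only [Pi.mul_apply, indicator_of_mem (hBD hx), mul_comm]
  have hlt : ∀ᵐ x ∂(volume.restrict B), ENNReal.ofReal (coareaFactor G x) < ⊤ :=
    ae_of_all _ fun _ => ENNReal.ofReal_lt_top
  obtain ⟨h1, h2, h3⟩ := Measure.integral_bind_of_lintegral_lt_top hκ hg (hbind ▸ hfin')
  have h4 := fun y => setIntegral_congr_fun (μ := areaMeasure d (d - j)) (hCm y) (hC y)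
  simp only [h4] at h2 h3
  refine ⟨?_, ?_, h2, ?_⟩
  · rw [← integrableOn_congr_fun hBeq hB]
    exact (integrable_withDensity_iff_integrable_smul' hJ hlt).1 ⟨hg.aestronglyMeasurable, hfin'⟩
  · filter_upwards [h1] with y hy
    exact (integrableOn_congr_fun (hC y) (hCm y)).1 hy
  · rw [← h3, hbind, integral_withDensity_eq_integral_toReal_smul hJ hlt,
      setIntegral_congr_fun hB hBeq]

end Disintegration

theorem mainTheorem4 (d j : ℕ) (hj : 0 < j) (hjd : j ≤ d)
    (D : Set (EuclideanSpace ℝ (Fin d))) (hD : IsOpen D)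
    (G : EuclideanSpace ℝ (Fin d) → EuclideanSpace ℝ (Fin j)) (hG : ContDiffOn ℝ 1 G D)
    (B : Set (EuclideanSpace ℝ (Fin d))) (hB : MeasurableSet B) (hBD : B ⊆ D) :
    -- nonnegative `f`
    (∀ f : EuclideanSpace ℝ (Fin j) → ENNReal, Measurable f →
      AEMeasurable (fun y => f y * areaMeasure d (d - j) (regularLevelSet D G B y)) volume ∧
      ∫⁻ x in B, f (G x) * ENNReal.ofReal (coareaFactor G x) =
        ∫⁻ y, f y * areaMeasure d (d - j) (regularLevelSet D G B y)) ∧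
    -- real-valued `f`, when one of the two integrals is finite
    (∀ f : EuclideanSpace ℝ (Fin j) → ℝ, Measurable f →
      ((∫⁻ x in B, ‖f (G x)‖ₑ * ENNReal.ofReal (coareaFactor G x)) < ⊤ ∨
        (∫⁻ y, ‖f y‖ₑ * areaMeasure d (d - j) (regularLevelSet D G B y)) < ⊤) →
      IntegrableOn (fun x => f (G x) * coareaFactor G x) B volume ∧
      (∀ᵐ y, f y ≠ 0 → areaMeasure d (d - j) (regularLevelSet D G B y) < ⊤) ∧
      Integrable (fun y => f y * (areaMeasure d (d - j) (regularLevelSet D G B y)).toReal) volume ∧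
      ∫ x in B, f (G x) * coareaFactor G x =
        ∫ y, f y * (areaMeasure d (d - j) (regularLevelSet D G B y)).toReal) ∧
    -- nonnegative `h`
    (∀ h : EuclideanSpace ℝ (Fin d) × EuclideanSpace ℝ (Fin j) → ENNReal, Measurable h →
      AEMeasurable
        (fun y => ∫⁻ x in regularLevelSet D G B y, h (x, y) ∂(areaMeasure d (d - j))) volume ∧
      ∫⁻ x in B, h (x, G x) * ENNReal.ofReal (coareaFactor G x) =
        ∫⁻ y, ∫⁻ x in regularLevelSet D G B y, h (x, y) ∂(areaMeasure d (d - j))) ∧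
    -- real-valued `h`, when one of the two integrals is finite
    (∀ h : EuclideanSpace ℝ (Fin d) × EuclideanSpace ℝ (Fin j) → ℝ, Measurable h →
      ((∫⁻ x in B, ‖h (x, G x)‖ₑ * ENNReal.ofReal (coareaFactor G x)) < ⊤ ∨
        (∫⁻ y, ∫⁻ x in regularLevelSet D G B y, ‖h (x, y)‖ₑ ∂(areaMeasure d (d - j))) < ⊤) →
      IntegrableOn (fun x => h (x, G x) * coareaFactor G x) B volume ∧
      (∀ᵐ y, IntegrableOn (fun x => h (x, y)) (regularLevelSet D G B y)
        (areaMeasure d (d - j))) ∧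
      Integrable
        (fun y => ∫ x in regularLevelSet D G B y, h (x, y) ∂(areaMeasure d (d - j))) volume ∧
      ∫ x in B, h (x, G x) * coareaFactor G x =
        ∫ y, ∫ x in regularLevelSet D G B y, h (x, y) ∂(areaMeasure d (d - j))) := by
  have hconst : ∀ (f : EuclideanSpace ℝ (Fin j) → ENNReal) (y : EuclideanSpace ℝ (Fin j)),
      ∫⁻ _ in regularLevelSet D G B y, f y ∂(areaMeasure d (d - j)) =
        f y * areaMeasure d (d - j) (regularLevelSet D G B y) := fun f y => setLIntegral_const _ _
  refine ⟨fun f hf => ?_, fun f hf hfin => ?_, fun h hh => ?_, fun h hh hfin => ?_⟩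
  · have := lintegral_coarea hjd hD hG hB hBD (hf.comp measurable_snd)
    simp only [Function.comp_apply, hconst] at this
    exact ⟨this.1.aemeasurable, this.2⟩
  · have := integral_coarea hjd hD hG hB hBD (hf.comp measurable_snd) (by
      simpa only [Function.comp_apply, hconst fun y => ‖f y‖ₑ] using hfin)
    simp only [Function.comp_apply, setIntegral_const, smul_eq_mul, measureReal_def,
      mul_comm _ (f _)] at this
    refine ⟨this.1, ?_, this.2.2⟩
    filter_upwards [this.2.1] with y hy hfy
    -- A nonzero constant is integrable only on a set of finite measure.
    exact ((integrableOn_const_iff (by simp)).1 hy).resolve_left (enorm_ne_zero.2 hfy)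
  · exact (lintegral_coarea hjd hD hG hB hBD hh).imp_left Measurable.aemeasurable
  · exact integral_coarea hjd hD hG hB hBD hh hfin
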